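/- Let $\mathbb K$ be an uncountable algebraically closed field of characteristic $0$. A \emph{toral variety} is an irreducible affine algebraic variety over $\mathbb K$ that is isomorphic to a closed subvariety of an algebraic torus $(\mathbb K^*)^d$ for some $d\ge 0$. For an affine variety $X$, let $\mathrm{Aut}(X)$ be its group of regular automorphisms. A \emph{torus} of dimension $n$ in $\mathrm{Aut}(X)$ is a subgroup that is the image of $(\mathbb K^*)^n$ under a faithful regular action $(\mathbb K^*)^n\times X\to X$; it is identified with the algebraic torus $(\mathbb K^*)^n$, and it is \emph{maximal} if it is not properly contained in another torus in $\mathrm{Aut}(X)$. An \emph{algebraic family} of automorphisms of $X$ parametrized by an affine variety $S$ is a family $(\varphi_s)_{s\in S}$ in $\mathrm{Aut}(X)$ such that $(s,x)\mapsto(s,\varphi_s(x))$ is an automorphism of the variety $S\times X$. The group $\mathrm{Aut}(X)$ is \emph{discrete} if its neutral component is trivial, that is, every algebraic family of automorphisms of $X$ parametrized by an irreducible affine variety is constant. \textbf{Theorem 1.} Let $X$ be a toral variety over $\mathbb K$. Then $\mathrm{Aut}(X)$ contains a unique maximal torus $T$, and there is an isomorphism of varieties $X\cong Y\times T$, where $Y$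 is a toral variety whose automorphism group $\mathrm{Aut}(Y)$ is discrete and whose maximal torus in $\mathrm{Aut}(Y)$ is trivial. -/

import Mathlib

universe u

/-- An affine algebraic variety over `K` (in the classical language of points, for `K`
algebraically closed): a set of points together with a finitely generated `K`-algebra `K[X]` of
`K`-valued regular functions, such that the points of `X` are exactly the `K`-algebra
homomorphisms `K[X] → K`. The variety need not be irreducible. -/
structure AffineVariety (K : Type u) [Field K] where
  /-- the points of the variety -/
  pts : Type u
  /-- the algebra of regular functions -/
  reg : Subalgebra K (pts → K)
  reg_fg : reg.FG
  eval_bijective : Function.Bijective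
    (fun x : pts => ((Pi.evalAlgHom K (fun _ : pts => K) x).comp reg.val : reg →ₐ[K] K))

namespace AffineVariety

variable {K : Type u} [Field K]

/-- Pullback of functions along a map, as a homomorphism of `K`-algebras. -/
def pullback (K : Type u) [Field K] {α β : Type u} (f : α → β) : (β → K) →ₐ[K] (α → K) where
  toFun g := g ∘ f
  map_one' := rfl
  map_mul' _ _ := rfl
  map_zero' := rfl
  map_add' _ _ := rfl
  commutes' _ := rfl

/-- Morphisms of affine varieties: maps that pull regular functions back to regular functions. -/
def IsRegularMap (X Y : AffineVariety K) (f : X.pts → Y.pts) : Prop :=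
  ∀ g ∈ Y.reg, g ∘ f ∈ X.reg

/-- Two affine varieties are isomorphic: there is a bijection, regular in both directions. -/
def Isomorphic (X Y : AffineVariety K) : Prop :=
  ∃ e : X.pts ≃ Y.pts, X.IsRegularMap Y e ∧ Y.IsRegularMap X e.symm

/-- The group of regular automorphisms of an affine variety. -/
def Aut (X : AffineVariety K) : Subgroup (Equiv.Perm X.pts) where
  carrier := {σ | X.IsRegularMap X σ ∧ X.IsRegularMap X σ.symm}
  one_mem' := ⟨fun _ hg => hg, fun _ hg => hg⟩
  mul_mem' := fun ha hb =>
    ⟨fun g hg => hb.1 _ (ha.1 g hg), fun g hg => ha.2 _ (hb.2 g hg)⟩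
  inv_mem' := fun h => ⟨h.2, h.1⟩

/-- Zariski closed subsets: common zero sets of regular functions. -/
def IsZariskiClosed (X : AffineVariety K) (Z : Set X.pts) : Prop :=
  ∃ F : Set (X.pts → K), F ⊆ X.reg ∧ Z = {x | ∀ f ∈ F, f x = 0}

/-- Irreducibility: nonempty, and not the union of two proper closed subsets. -/
def IsIrreducible (X : AffineVariety K) : Prop :=
  Nonempty X.pts ∧ ∀ Z₁ Z₂ : Set X.pts, X.IsZariskiClosed Z₁ → X.IsZariskiClosed Z₂ →
    Z₁ ∪ Z₂ = Set.univ → Z₁ = Set.univ ∨ Z₂ = Set.univ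

/-- A Zariski closed subset `Z` of `X` as an affine variety; the regular functions on it are the
restrictions of the regular functions on `X`. -/
def closedSubvariety (X : AffineVariety K) (Z : Set X.pts) (hZ : X.IsZariskiClosed Z) :
    AffineVariety K where
  pts := Z
  reg := X.reg.map (pullback K (Subtype.val : Z → X.pts))
  reg_fg := X.reg_fg.map _
  eval_bijective := by
    constructor
    · intro x y h
      apply Subtype.ext
      apply X.eval_bijective.1
      ext ⟨g, hg⟩
      exact DFunLike.congr_fun h ⟨_, Subalgebra.mem_map.2 ⟨g, hg, rfl⟩⟩
    · intro φ
      let r : X.reg →ₐ[K] X.reg.map (pullback K (Subtype.val : Z → X.pts)) :=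
        ((pullback K (Subtype.val : Z → X.pts)).comp X.reg.val).codRestrict _
          (fun g => Subalgebra.mem_map.2 ⟨g, g.2, rfl⟩)
      obtain ⟨x, hx⟩ := X.eval_bijective.2 (φ.comp r)
      obtain ⟨F, hF, hZF⟩ := hZ
      have hxZ : x ∈ Z := by
        rw [hZF]
        intro f hf
        have h1 : f x = φ (r ⟨f, hF hf⟩) := DFunLike.congr_fun hx ⟨f, hF hf⟩
        have h2 : r ⟨f, hF hf⟩ = 0 := by
          apply Subtype.ext
          funext z
          have hz : (z : X.pts) ∈ {x | ∀ f ∈ F, f x = 0} := hZF.le z.2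
          exact hz f hf
        rw [h1, h2, map_zero]
      refine ⟨⟨x, hxZ⟩, ?_⟩
      ext ⟨g, hg⟩
      obtain ⟨f, hf, rfl⟩ := Subalgebra.mem_map.1 hg
      exact DFunLike.congr_fun hx ⟨f, hf⟩

/-- The product of two affine varieties; its algebra of regular functions is generated by the
regular functions on the factors, so it is the algebra of the functions
`(x, y) ↦ ∑ fᵢ(x) gᵢ(y)`. -/
def prod (X Y : AffineVariety K) : AffineVariety K where
  pts := X.pts × Y.pts
  reg := X.reg.map (pullback K (Prod.fst : X.pts × Y.pts → X.pts)) ⊔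
    Y.reg.map (pullback K (Prod.snd : X.pts × Y.pts → Y.pts))
  reg_fg := (X.reg_fg.map _).sup (Y.reg_fg.map _)
  eval_bijective := by
    set A := X.reg.map (pullback K (Prod.fst : X.pts × Y.pts → X.pts)) with hA
    set B := Y.reg.map (pullback K (Prod.snd : X.pts × Y.pts → Y.pts)) with hB
    have mA : ∀ g ∈ X.reg, g ∘ Prod.fst ∈ A ⊔ B := fun g hg =>
      (le_sup_left : A ≤ A ⊔ B) (Subalgebra.mem_map.2 ⟨g, hg, rfl⟩)
    have mB : ∀ g ∈ Y.reg, g ∘ Prod.snd ∈ A ⊔ B := fun g hg =>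
      (le_sup_right : B ≤ A ⊔ B) (Subalgebra.mem_map.2 ⟨g, hg, rfl⟩)
    constructor
    · rintro ⟨x, y⟩ ⟨x', y'⟩ h
      apply Prod.ext
      · apply X.eval_bijective.1
        ext ⟨g, hg⟩
        exact DFunLike.congr_fun h ⟨_, mA g hg⟩
      · apply Y.eval_bijective.1
        ext ⟨g, hg⟩
        exact DFunLike.congr_fun h ⟨_, mB g hg⟩
    · intro φ
      let r : X.reg →ₐ[K] (A ⊔ B : Subalgebra K (X.pts × Y.pts → K)) :=
        ((pullback K Prod.fst).comp X.reg.val).codRestrict _ (fun g => mA g g.2)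
      let s : Y.reg →ₐ[K] (A ⊔ B : Subalgebra K (X.pts × Y.pts → K)) :=
        ((pullback K Prod.snd).comp Y.reg.val).codRestrict _ (fun g => mB g g.2)
      obtain ⟨x, hx⟩ := X.eval_bijective.2 (φ.comp r)
      obtain ⟨y, hy⟩ := Y.eval_bijective.2 (φ.comp s)
      refine ⟨(x, y), ?_⟩
      let E : Subalgebra K (A ⊔ B : Subalgebra K (X.pts × Y.pts → K)) :=
        AlgHom.equalizer
          ((Pi.evalAlgHom K (fun _ : X.pts × Y.pts => K) (x, y)).comp (A ⊔ B).val) φ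
      have hE : A ⊔ B ≤ E.map (A ⊔ B).val := by
        refine sup_le ?_ ?_
        · rintro _ ⟨g, hg, rfl⟩
          exact Subalgebra.mem_map.2 ⟨⟨_, mA g hg⟩,
            (AlgHom.mem_equalizer _ _ _).2 (DFunLike.congr_fun hx ⟨g, hg⟩), rfl⟩
        · rintro _ ⟨g, hg, rfl⟩
          exact Subalgebra.mem_map.2 ⟨⟨_, mB g hg⟩,
            (AlgHom.mem_equalizer _ _ _).2 (DFunLike.congr_fun hy ⟨g, hg⟩), rfl⟩
      ext ⟨g, hg⟩
      obtain ⟨g', hg', h⟩ := Subalgebra.mem_map.1 (hE hg)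
      obtain rfl : g' = ⟨g, hg⟩ := Subtype.ext h
      exact hg'

/-- The algebraic torus `(K^*)ⁿ`; its regular functions are the Laurent polynomials in the
coordinates. -/
def torus (K : Type u) [Field K] (n : ℕ) : AffineVariety K where
  pts := Fin n → Kˣ
  reg := Algebra.adjoin K
    (Set.range (fun (i : Fin n) (t : Fin n → Kˣ) => (t i : K)) ∪
      Set.range (fun (i : Fin n) (t : Fin n → Kˣ) => ((t i)⁻¹ : K)))
  reg_fg := Subalgebra.fg_def.2 ⟨_, (Set.finite_range _).union (Set.finite_range _), rfl⟩
  eval_bijective := by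
    set G : Set ((Fin n → Kˣ) → K) :=
      Set.range (fun (i : Fin n) (t : Fin n → Kˣ) => (t i : K)) ∪
      Set.range (fun (i : Fin n) (t : Fin n → Kˣ) => ((t i)⁻¹ : K)) with hG
    have m1 : ∀ i : Fin n, (fun t : Fin n → Kˣ => (t i : K)) ∈ Algebra.adjoin K G :=
      fun i => Algebra.subset_adjoin (Or.inl ⟨i, rfl⟩)
    have m2 : ∀ i : Fin n, (fun t : Fin n → Kˣ => ((t i)⁻¹ : K)) ∈ Algebra.adjoin K G :=
      fun i => Algebra.subset_adjoin (Or.inr ⟨i, rfl⟩)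
    constructor
    · intro s t h
      funext i
      apply Units.ext
      exact DFunLike.congr_fun h ⟨_, m1 i⟩
    · intro φ
      have hmul : ∀ i, φ ⟨_, m1 i⟩ * φ ⟨_, m2 i⟩ = 1 := by
        intro i
        rw [← map_mul, ← map_one φ]
        congr 1
        apply Subtype.ext
        funext t
        exact mul_inv_cancel₀ (t i).ne_zero
      refine ⟨fun i => Units.mkOfMulEqOne _ _ (hmul i), ?_⟩
      refine AlgHom.adjoin_ext ?_
      rintro g (⟨i, rfl⟩ | ⟨i, rfl⟩) 
      · rfl
      · exact inv_eq_of_mul_eq_one_right (hmul i)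

/-- `X` is toral: irreducible and isomorphic to a closed subvariety of some torus `(K^*)ᵈ`. -/
def IsToral (X : AffineVariety K) : Prop :=
  X.IsIrreducible ∧ ∃ (d : ℕ) (Z : Set (torus K d).pts) (hZ : (torus K d).IsZariskiClosed Z),
    X.Isomorphic ((torus K d).closedSubvariety Z hZ)

/-- `T` is an `n`-dimensional torus in `Aut X`: the image of a faithful regular action
`(K^*)ⁿ × X → X` of the algebraic torus `(K^*)ⁿ`. Thus `T` is identified with the algebraic torus
`(K^*)ⁿ`. -/
def IsTorusOfRank (X : AffineVariety K) (n : ℕ) (T : Subgroup X.Aut) : Prop :=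
  ∃ ρ : (Fin n → Kˣ) →* X.Aut, Function.Injective ρ ∧ ρ.range = T ∧
    ((torus K n).prod X).IsRegularMap X (fun p => (ρ p.1).1 p.2)

/-- `T` is an algebraic torus in `Aut X`, of some dimension. -/
def IsTorus (X : AffineVariety K) (T : Subgroup X.Aut) : Prop :=
  ∃ n : ℕ, X.IsTorusOfRank n T

/-- `T` is a maximal torus in `Aut X`: maximal, with respect to inclusion, among the algebraic
tori in `Aut X`. -/
def IsMaximalTorus (X : AffineVariety K) (T : Subgroup X.Aut) : Prop :=
  Maximal X.IsTorus T

/-- An algebraic family of automorphisms of `X` parametrized by `S`: a family `Φ` for which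
`(s, x) ↦ (s, Φ s x)` is an automorphism of `S × X`. -/
def IsAlgebraicFamily (X S : AffineVariety K) (Φ : S.pts → X.Aut) : Prop :=
  (S.prod X).IsRegularMap X (fun p => (Φ p.1).1 p.2) ∧
    (S.prod X).IsRegularMap X (fun p => (Φ p.1).1.symm p.2)

/-- `Aut X` is discrete, i.e. its neutral component is trivial: every algebraic family of
automorphisms of `X` parametrized by an irreducible variety is constant. -/
def HasDiscreteAut (X : AffineVariety K) : Prop :=
  ∀ S : AffineVariety K, S.IsIrreducible → ∀ Φ : S.pts → X.Aut, X.IsAlgebraicFamily S Φ →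
    ∀ s s' : S.pts, Φ s = Φ s'

end AffineVariety

/-!
Fix an embedding `z` of `X` into a torus `(K^*)ᵈ`. The coordinates of `z` are units of `K[X]`, and
they generate `K[X]` together with their inverses.

*Families are translations.* If `(φ_s)` is a family of automorphisms with irreducible base `S`, then
`(s, x) ↦ zᵢ(φ_s(x))` is a unit on `S × X`, hence by Rosenlicht's lemma
(`mul_eq_mul_of_unit_prod`) a product `cᵢ(s) bᵢ(x)`. So any two members of the family differ by a
translation of `(K^*)ᵈ` preserving `X` (`IsTorusEmbedding.exists_translation`).

Rosenlicht's lemma is proved with valuations. Let `F` be a unit on `S × X`, and `v` a valuation of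
`K(S)` that is trivial on `K`. At every point `x` of `X`, the value `v(F(·, x))` is at least the
Gauss value of `F`, and the same holds for `F⁻¹`. The two Gauss values add up to `0`, so there is
equality at every `x`. Hence `F(·, x) / F(·, x₀)` is a unit of every valuation ring of `K(S)`
containing `K`, which makes it a constant.

*The stabilizer.* Let `H` be the group of all translations preserving `X`. Linear independence of
characters shows that `H` is cut out by characters (`mem_translationStabilizer_of_monomial`). The
exponents of the characters of finite order on `H` form a saturated sublattice of `ℤᵈ`, which splits
off, so the common kernel `H°` of these characters is a torus `(K^*)ʳ` and a direct factor of
`(K^*)ᵈ` (`exists_dualHom_neutralComponent`). A regular map from an irreducible variety to `H` that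
takes the value `1` has its image in `H°`, since a unit of finite order on an irreducible variety is
constant. Hence `H°` contains every torus of `Aut X`: it is the greatest one.

*The complement.* Let `w : (K^*)ᵈ → (K^*)ʳ` be the monomial retraction onto the factor `H°`, and let
`Y ⊆ X` be defined by `w = 1`. Then `x ↦ (w(x)⁻¹ x, w(x))` is an isomorphism from `X` to
`Y × (K^*)ʳ`. A translation preserving `Y` preserves `X` too, so the translations occurring in an
irreducible family of automorphisms of `Y` lie in `H°`, up to a fixed one; as they preserve `w = 1`
they are trivial, and `Aut Y` is discrete.
-/

namespace AffineVariety

variable {K : Type u} [Field K]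

/-! ### Irreducibility and integral elements -/

theorem IsIrreducible.exists_ne_zero {X : AffineVariety K} (hX : X.IsIrreducible)
    {f g : X.pts → K} (hf : f ∈ X.reg) (hg : g ∈ X.reg) (hf0 : f ≠ 0) (hg0 : g ≠ 0) :
    ∃ x, f x ≠ 0 ∧ g x ≠ 0 := by
  by_contra! h
  rcases hX.2 {x | f x = 0} {x | g x = 0} ⟨{f}, by simpa using hf, by simp⟩
    ⟨{g}, by simpa using hg, by simp⟩
    (Set.eq_univ_of_forall fun x => or_iff_not_imp_left.2 (h x)) with h1 | h1
  · exact hf0 (funext fun x => h1.ge (Set.mem_univ x))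
  · exact hg0 (funext fun x => h1.ge (Set.mem_univ x))

theorem IsIrreducible.isDomain {X : AffineVariety K} (hX : X.IsIrreducible) : IsDomain X.reg := by
  have : Nonempty X.pts := hX.1
  have : NoZeroDivisors X.reg := by
    refine ⟨fun {f g} h => ?_⟩
    by_contra! hfg
    obtain ⟨x, hx, hx'⟩ := hX.exists_ne_zero f.2 g.2 (fun h => hfg.1 (Subtype.ext h))
      (fun h => hfg.2 (Subtype.ext h))
    exact mul_ne_zero hx hx' (congrFun (congrArg Subtype.val h) x)
  exact NoZeroDivisors.to_isDomain _

theorem exists_algebraMap_eq_of_isIntegral [IsAlgClosed K] {A : Type*} [CommRing A] [IsDomain A]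
    [Algebra K A] {a : A} (ha : IsIntegral K a) : ∃ c : K, algebraMap K A c = a := by
  obtain ⟨c, hc⟩ := (IsAlgClosed.algebraMap_bijective_of_isIntegral
    (k := K) (K := integralClosure K A)).2 ⟨a, ha⟩
  exact ⟨c, congrArg Subtype.val hc⟩

/-- An element of a field extension of an algebraically closed field `K` that lies in every
valuation ring containing `K` is a constant. -/
theorem exists_algebraMap_eq_of_forall_valuationSubring [IsAlgClosed K] {L : Type*} [Field L]
    [Algebra K L] {a : L}
    (ha : ∀ V : ValuationSubring L, (∀ c : K, algebraMap K L c ∈ V) → a ∈ V) :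
    ∃ c : K, algebraMap K L c = a := by
  apply exists_algebraMap_eq_of_isIntegral
  have h : a ∈ (⨅ V : {V : ValuationSubring L //
      ((algebraMap K L).range : Set L) ⊆ V.toSubring}, V.1.toSubring) := by
    rw [Subring.mem_iInf]
    rintro ⟨V, hV⟩
    exact ha V fun c => hV ⟨c, rfl⟩
  rw [iInf_valuationSubring_superset, Subring.closure_eq] at h
  obtain ⟨p, hp, hpa⟩ := (h : IsIntegral (algebraMap K L).range a)
  have hs := (algebraMap K L).rangeRestrict_surjective
  obtain ⟨q, hq, -, hqm⟩ := Polynomial.lifts_and_natDegree_eq_and_monic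
    (f := (algebraMap K L).rangeRestrict) (p := p)
    ((Polynomial.mem_lifts p).2 (Polynomial.map_surjective _ hs p)) hp
  refine ⟨q, hqm, ?_⟩
  rw [← hq, Polynomial.eval₂_map] at hpa
  exact hpa

/-! ### Units on a product of irreducible varieties -/

/-- A regular function on `S × X` is a combination of basis elements of `K[X]` with coefficients in
`K[S]`. -/
theorem exists_finsupp_of_mem_prod_reg (S X : AffineVariety K) {ι : Type*}
    (β : Module.Basis ι K X.reg) {F : S.pts × X.pts → K} (hF : F ∈ (S.prod X).reg) :
    ∃ α : ι →₀ S.reg, ∀ s x,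
      F (s, x) = α.sum fun i a => (a : S.pts → K) s * (β i : X.pts → K) x := by
  change F ∈ Subalgebra.toSubmodule (_ ⊔ _) at hF
  rw [← Subalgebra.mul_toSubmodule] at hF
  refine Submodule.mul_induction_on hF (fun f hf g hg => ?_) (fun f g hf hg => ?_)
  · obtain ⟨a, ha, rfl⟩ := Subalgebra.mem_map.1 hf
    obtain ⟨b, hb, rfl⟩ := Subalgebra.mem_map.1 hg
    refine ⟨(β.repr ⟨b, hb⟩).mapRange (fun c => c • (⟨a, ha⟩ : S.reg)) (zero_smul _ _),
      fun s x => ?_⟩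
    have h := congrFun (congrArg Subtype.val (β.linearCombination_repr ⟨b, hb⟩)) x
    rw [Finsupp.sum_mapRange_index (by simp)]
    change a s * b x = _
    rw [← show _ = b x from h, Finsupp.linearCombination_apply, Finsupp.sum, Finsupp.sum]
    simp [Finset.mul_sum, mul_assoc, mul_left_comm]
  · classical
    obtain ⟨α, hα⟩ := hf
    obtain ⟨α', hα'⟩ := hg
    refine ⟨α + α', fun s x => ?_⟩
    rw [Finsupp.sum_add_index' (by simp) (by intros; simp [add_mul]), ← hα, ← hα']
    rfl

/-- Gauss normalization. A nonzero combination `P` of regular functions on `X` with coefficients in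
a field `L ⊇ K` can be scaled, for each valuation ring `V ⊇ K` of `L`, so that all its values lie
in `V` and those outside a proper closed subset are units of `V`. -/
theorem exists_scaling_mem_valuationSubring (X : AffineVariety K) {L : Type*} [Field L]
    [Algebra K L] {ι : Type*} (β : Module.Basis ι K X.reg) (α : ι →₀ L) (hα : α ≠ 0)
    (V : ValuationSubring L) (hV : ∀ c : K, algebraMap K L c ∈ V) :
    ∃ δ : L, δ ≠ 0 ∧
      (∀ x, δ * (α.sum fun i a => a * algebraMap K L ((β i : X.pts → K) x)) ∈ V) ∧
      ∃ f ∈ X.reg, f ≠ 0 ∧ ∀ x, f x ≠ 0 →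
        (δ * (α.sum fun i a => a * algebraMap K L ((β i : X.pts → K) x)))⁻¹ ∈ V := by
  obtain ⟨i₀, hi₀, hmax⟩ := Finset.exists_max_image α.support (fun i => V.valuation (α i))
    (Finsupp.support_nonempty_iff.2 hα)
  have h0 : α i₀ ≠ 0 := Finsupp.mem_support_iff.1 hi₀
  have hmem : ∀ i, (α i₀)⁻¹ * α i ∈ V := by
    intro i
    rw [← V.valuation_le_one_iff, map_mul, map_inv₀]
    by_cases hi : i ∈ α.support
    · rw [mul_comm]
      exact mul_inv_le_one_of_le₀ (hmax i hi) zero_le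
    · simp [Finsupp.notMem_support_iff.1 hi]
  let o : ι → V := fun i => ⟨_, hmem i⟩
  let e : K →+* V := (algebraMap K L).codRestrict V.toSubring hV
  let p : X.pts → V := fun x => ∑ i ∈ α.support, o i * e ((β i : X.pts → K) x)
  have hp : ∀ x, (p x : L) =
      (α i₀)⁻¹ * (α.sum fun i a => a * algebraMap K L ((β i : X.pts → K) x)) := by
    intro x
    simp only [p, AddSubmonoidClass.coe_finsetSum, Finsupp.sum, Finset.mul_sum]
    refine Finset.sum_congr rfl fun i _ => ?_
    exact mul_assoc _ _ _
  let res := IsLocalRing.residue V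
  let : Algebra K (IsLocalRing.ResidueField V) := (res.comp e).toAlgebra
  -- a `K`-linear functional on the residue field brings the reduction of `P` back to a
  -- regular function on `X`
  obtain ⟨l, hl⟩ := LinearMap.exists_leftInverse_of_injective
    (Algebra.linearMap K (IsLocalRing.ResidueField V))
    (LinearMap.ker_eq_bot.2 (FaithfulSMul.algebraMap_injective _ _))
  let f : X.reg := ∑ i ∈ α.support, l (res (o i)) • β i
  have hf : ∀ x, (f : X.pts → K) x = l (res (p x)) := by
    intro x
    simp only [f, p, AddSubmonoidClass.coe_finsetSum, map_sum, Finset.sum_apply]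
    refine Finset.sum_congr rfl fun i _ => ?_
    rw [map_mul, mul_comm, show res (e ((β i : X.pts → K) x)) * res (o i) =
      ((β i : X.pts → K) x) • res (o i) from (Algebra.smul_def _ _).symm, map_smul]
    exact mul_comm _ _
  refine ⟨(α i₀)⁻¹, inv_ne_zero h0, fun x => hp x ▸ (p x).2, f, f.2, fun h => ?_, fun x hx => ?_⟩
  · have h1 := (linearIndependent_iff'.1 β.linearIndependent) α.support
      (fun i => l (res (o i))) (Subtype.ext h) i₀ hi₀
    have h2 : o i₀ = 1 := Subtype.ext (inv_mul_cancel₀ h0)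
    have h3 := DFunLike.congr_fun hl 1
    simp only [h2, map_one] at h1
    simp [h1] at h3
  · rw [← hp]
    have hu : IsUnit (p x) := by
      rw [← IsLocalRing.residue_ne_zero_iff_isUnit]
      intro h
      exact hx (by rw [hf, show res (p x) = 0 from h, map_zero])
    obtain ⟨v, hv⟩ := hu.exists_right_inv
    have : (p x : L)⁻¹ = v := inv_eq_of_mul_eq_one_right (congrArg Subtype.val hv)
    exact this ▸ v.2

/-- A unit `F` on `S × X` restricts to proportional functions on the fibres `S × {x}` and
`S × {x₀}`. Their quotient is a constant as it lies in every valuation ring `V ⊇ K` of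
the function field `L` of `S`: after Gauss normalization `F` and its inverse `G` take values in `V`,
and the product of the two scaling factors is a unit of `V`. -/
theorem exists_eq_const_mul_of_unit_prod [IsAlgClosed K] {S X : AffineVariety K}
    (hS : S.IsIrreducible) (hX : X.IsIrreducible) {F G : S.pts × X.pts → K}
    (hF : F ∈ (S.prod X).reg) (hG : G ∈ (S.prod X).reg) (hFG : ∀ p, F p * G p = 1)
    (L : Type*) [Field L] [Algebra S.reg L] [IsFractionRing S.reg L] [Algebra K L]
    [IsScalarTower K S.reg L] (x x₀ : X.pts) : ∃ c : K, ∀ s, F (s, x) = c * F (s, x₀) := by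
  have := hS.isDomain
  let β := Module.Basis.ofVectorSpace K X.reg
  have key : ∀ {F : S.pts × X.pts → K}, F ∈ (S.prod X).reg →
      ∃ (α : Module.Basis.ofVectorSpaceIndex K X.reg →₀ L) (a : X.pts → S.reg),
        (∀ s x, F (s, x) = (a x : S.pts → K) s) ∧
        ∀ x, (α.sum fun i c => c * algebraMap K L ((β i : X.pts → K) x)) =
          algebraMap S.reg L (a x) := by
    intro F hF
    obtain ⟨α, hα⟩ := exists_finsupp_of_mem_prod_reg S X β hF
    refine ⟨α.mapRange (algebraMap S.reg L) (map_zero _),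
      fun x => α.sum fun i c => c * algebraMap K S.reg ((β i : X.pts → K) x), fun s x => ?_,
      fun x => ?_⟩
    · rw [hα]
      simp only [Finsupp.sum, AddSubmonoidClass.coe_finsetSum, Finset.sum_apply]
      rfl
    · rw [Finsupp.sum_mapRange_index (by simp)]
      simp only [Finsupp.sum, map_sum]
      refine Finset.sum_congr rfl fun i _ => ?_
      rw [map_mul, ← IsScalarTower.algebraMap_apply]
  obtain ⟨α, a, ha, hαa⟩ := key hF
  obtain ⟨γ, b, hb, hγb⟩ := key hG
  have hab : ∀ x, a x * b x = 1 := by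
    intro x
    apply Subtype.ext
    funext s
    have := hFG (s, x)
    rwa [ha, hb] at this
  have habL : ∀ x, algebraMap S.reg L (a x) * algebraMap S.reg L (b x) = 1 := fun x => by
    rw [← map_mul, hab, map_one]
  have hα0 : α ≠ 0 := by
    rintro rfl
    have := habL x
    rw [← hαa] at this
    simp at this
  have hγ0 : γ ≠ 0 := by
    rintro rfl
    have := habL x
    rw [← hγb] at this
    simp at this
  obtain ⟨c, hc⟩ := exists_algebraMap_eq_of_forall_valuationSubring (K := K)
    (a := algebraMap S.reg L (a x) * algebraMap S.reg L (b x₀)) (by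
      intro V hV
      obtain ⟨δ, hδ, hδV, f, hf, hf0, hfV⟩ :=
        exists_scaling_mem_valuationSubring X β α hα0 V hV
      obtain ⟨ε, hε, hεV, g, hg, hg0, hgV⟩ :=
        exists_scaling_mem_valuationSubring X β γ hγ0 V hV
      simp only [hαa, hγb] at hδV hfV hεV hgV
      obtain ⟨y, hfy, hgy⟩ := hX.exists_ne_zero hf hg hf0 hg0
      -- `(δ a(x)) (ε b(x)) = δ ε` does not depend on `x`, and it is a unit of `V` by looking at `y`
      have h1 : (δ * ε)⁻¹ ∈ V := by
        have := V.mul_mem _ _ (hfV y hfy) (hgV y hgy)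
        rwa [← mul_inv, mul_mul_mul_comm, habL, mul_one] at this
      have := V.mul_mem _ _ (V.mul_mem _ _ (hδV x) (hεV x₀)) h1
      convert this using 1
      field_simp)
  have hcA : a x = algebraMap K S.reg c * a x₀ := by
    apply IsFractionRing.injective S.reg L
    rw [map_mul, ← IsScalarTower.algebraMap_apply, hc, mul_assoc,
      mul_comm (algebraMap S.reg L (b x₀)), habL, mul_one]
  exact ⟨c, fun s => by rw [ha, ha, hcA]; rfl⟩

/-- **Rosenlicht's lemma**: a unit on a product of irreducible affine varieties is a product of
functions on the factors. -/
theorem mul_eq_mul_of_unit_prod [IsAlgClosed K] {S X : AffineVariety K} (hS : S.IsIrreducible)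
    (hX : X.IsIrreducible) {F G : S.pts × X.pts → K} (hF : F ∈ (S.prod X).reg)
    (hG : G ∈ (S.prod X).reg) (hFG : ∀ p, F p * G p = 1) (s s₀ : S.pts) (x x₀ : X.pts) :
    F (s, x) * F (s₀, x₀) = F (s, x₀) * F (s₀, x) := by
  have := hS.isDomain
  obtain ⟨c, hc⟩ := exists_eq_const_mul_of_unit_prod hS hX hF hG hFG (FractionRing S.reg) x x₀
  rw [hc, hc]
  ring

/-! ### Regular units and monomials -/

/-- The nowhere vanishing regular functions with regular inverse, as a group of functions with
values in `Kˣ`. -/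
def regularUnits (X : AffineVariety K) : Subgroup (X.pts → Kˣ) where
  carrier := {u | (fun x => (u x : K)) ∈ X.reg ∧ (fun x => ((u x)⁻¹ : K)) ∈ X.reg}
  one_mem' := by
    refine ⟨X.reg.one_mem, ?_⟩
    convert X.reg.one_mem using 1
    funext x
    simp
  mul_mem' {u v} hu hv := by
    refine ⟨?_, ?_⟩
    · convert X.reg.mul_mem hu.1 hv.1 using 1
      funext x
      simp
    · convert X.reg.mul_mem hu.2 hv.2 using 1
      funext x
      simp [mul_comm]
  inv_mem' {u} hu := by
    refine ⟨?_, ?_⟩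
    · simpa using hu.2
    · simpa using hu.1

theorem const_mem_regularUnits (X : AffineVariety K) (c : Kˣ) :
    (fun _ => c) ∈ X.regularUnits :=
  ⟨X.reg.algebraMap_mem (c : K), X.reg.algebraMap_mem ((c : K)⁻¹)⟩

theorem IsRegularMap.comp_mem_regularUnits {X Y : AffineVariety K} {f : X.pts → Y.pts}
    (hf : X.IsRegularMap Y f) {u : Y.pts → Kˣ} (hu : u ∈ Y.regularUnits) :
    (fun x => u (f x)) ∈ X.regularUnits :=
  ⟨hf _ hu.1, hf _ hu.2⟩

theorem isRegularMap_fst (X Y : AffineVariety K) : (X.prod Y).IsRegularMap X Prod.fst :=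
  fun g hg => (le_sup_left : _ ≤ (X.prod Y).reg) (Subalgebra.mem_map.2 ⟨g, hg, rfl⟩)

theorem isRegularMap_snd (X Y : AffineVariety K) : (X.prod Y).IsRegularMap Y Prod.snd :=
  fun g hg => (le_sup_right : _ ≤ (X.prod Y).reg) (Subalgebra.mem_map.2 ⟨g, hg, rfl⟩)

theorem IsRegularMap.prodMk {P X Y : AffineVariety K} {f : P.pts → X.pts} {g : P.pts → Y.pts}
    (hf : P.IsRegularMap X f) (hg : P.IsRegularMap Y g) :
    P.IsRegularMap (X.prod Y) fun p => (f p, g p) := by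
  suffices h : (X.prod Y).reg ≤ P.reg.comap (pullback K fun p => (f p, g p)) from fun u hu => h hu
  refine sup_le ?_ ?_
  · rintro _ ⟨u, hu, rfl⟩
    exact hf u hu
  · rintro _ ⟨u, hu, rfl⟩
    exact hg u hu

theorem IsRegularMap.comp {X Y Z : AffineVariety K} {g : Y.pts → Z.pts} {f : X.pts → Y.pts}
    (hg : Y.IsRegularMap Z g) (hf : X.IsRegularMap Y f) : X.IsRegularMap Z fun x => g (f x) :=
  fun u hu => hf _ (hg u hu)

/-- The Laurent monomial with exponent vector `m`, as a character of the torus `(K^*)ᵈ`. -/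
def monomial {d : ℕ} (m : Fin d → ℤ) : (Fin d → Kˣ) →* Kˣ where
  toFun t := ∏ i, t i ^ m i
  map_one' := by simp
  map_mul' s t := by simp [mul_zpow, Finset.prod_mul_distrib]

theorem monomial_apply {d : ℕ} (m : Fin d → ℤ) (t : Fin d → Kˣ) :
    monomial m t = ∏ i, t i ^ m i := rfl

theorem monomial_zero {d : ℕ} (t : Fin d → Kˣ) : monomial 0 t = 1 := by
  simp [monomial_apply]

theorem monomial_add {d : ℕ} (m n : Fin d → ℤ) (t : Fin d → Kˣ) :
    monomial (m + n) t = monomial m t * monomial n t := by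
  simp [monomial_apply, zpow_add, Finset.prod_mul_distrib]

theorem monomial_neg {d : ℕ} (m : Fin d → ℤ) (t : Fin d → Kˣ) :
    monomial (-m) t = (monomial m t)⁻¹ := by
  simp [monomial_apply]

theorem monomial_sub {d : ℕ} (m n : Fin d → ℤ) (t : Fin d → Kˣ) :
    monomial (m - n) t = monomial m t / monomial n t := by
  rw [sub_eq_add_neg, monomial_add, monomial_neg, div_eq_mul_inv]

theorem monomial_zsmul {d : ℕ} (k : ℤ) (m : Fin d → ℤ) (t : Fin d → Kˣ) :
    monomial (k • m) t = monomial m t ^ k := by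
  simp [monomial_apply, Finset.prod_zpow, mul_comm k, zpow_mul]

theorem monomial_sum {d : ℕ} {ι : Type*} (s : Finset ι) (m : ι → Fin d → ℤ) (t : Fin d → Kˣ) :
    monomial (∑ i ∈ s, m i) t = ∏ i ∈ s, monomial (m i) t := by
  classical
  induction s using Finset.induction_on with
  | empty => simp [monomial_zero]
  | insert a s ha ih => rw [Finset.sum_insert ha, Finset.prod_insert ha, monomial_add, ih]

theorem monomial_single {d : ℕ} (i : Fin d) (t : Fin d → Kˣ) :
    monomial (Pi.single i 1) t = t i := by
  rw [monomial_apply, Finset.prod_eq_single i] <;> simp +contextual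

theorem monomial_comp_mem_regularUnits {P : AffineVariety K} {d : ℕ} {u : P.pts → Fin d → Kˣ}
    (hu : ∀ i, (fun p => u p i) ∈ P.regularUnits) (m : Fin d → ℤ) :
    (fun p => monomial m (u p)) ∈ P.regularUnits := by
  have := P.regularUnits.prod_mem (t := Finset.univ) (f := fun i => (fun p => u p i) ^ m i)
    fun i _ => P.regularUnits.zpow_mem (hu i) (m i)
  convert this using 1
  funext p
  simp [monomial_apply]

theorem coord_mem_regularUnits_torus (d : ℕ) (i : Fin d) :
    (fun t : Fin d → Kˣ => t i) ∈ (torus K d).regularUnits := by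
  have h : ∀ f ∈ Set.range (fun (i : Fin d) (t : Fin d → Kˣ) => (t i : K)) ∪
      Set.range (fun (i : Fin d) (t : Fin d → Kˣ) => ((t i)⁻¹ : K)),
      f ∈ Algebra.adjoin K (Set.range (fun (i : Fin d) (t : Fin d → Kˣ) => (t i : K)) ∪
        Set.range (fun (i : Fin d) (t : Fin d → Kˣ) => ((t i)⁻¹ : K))) :=
    fun f hf => Algebra.subset_adjoin hf
  exact ⟨h _ (Or.inl ⟨i, rfl⟩), h _ (Or.inr ⟨i, rfl⟩)⟩

/-- A map to a torus is regular as soon as its coordinates are regular units. -/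
theorem isRegularMap_torus {P : AffineVariety K} {d : ℕ} {u : P.pts → Fin d → Kˣ}
    (hu : ∀ i, (fun p => u p i) ∈ P.regularUnits) : P.IsRegularMap (torus K d) u := by
  suffices h : (torus K d).reg ≤ P.reg.comap (pullback K u) from fun g hg => h hg
  refine Algebra.adjoin_le ?_
  rintro _ (⟨i, rfl⟩ | ⟨i, rfl⟩)
  · exact (hu i).1
  · exact (hu i).2

/-- Regular functions on a torus are Laurent polynomials. -/
theorem exists_finsupp_of_mem_torus_reg {d : ℕ} {g : (Fin d → Kˣ) → K} (hg : g ∈ (torus K d).reg) :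
    ∃ a : (Fin d → ℤ) →₀ K, ∀ t, g t = a.sum fun m c => c * (monomial m t : K) := by
  have hmon : ∀ f ∈ Submonoid.closure
      (Set.range (fun (i : Fin d) (t : Fin d → Kˣ) => (t i : K)) ∪
        Set.range (fun (i : Fin d) (t : Fin d → Kˣ) => ((t i)⁻¹ : K))),
      ∃ m, (fun t => (monomial m t : K)) = f := by
    intro f hf
    induction hf using Submonoid.closure_induction with
    | mem f hf =>
      rcases hf with ⟨i, rfl⟩ | ⟨i, rfl⟩
      · exact ⟨Pi.single i 1, by simp [monomial_single]⟩
      · exact ⟨-Pi.single i 1, by simp [monomial_neg, monomial_single]⟩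
    | one => exact ⟨0, by simp [monomial_zero, Pi.one_def]⟩
    | mul f g _ _ hf hg =>
      obtain ⟨m, rfl⟩ := hf
      obtain ⟨n, rfl⟩ := hg
      exact ⟨m + n, by funext t; simp [monomial_add]⟩
  have h : g ∈ Subalgebra.toSubmodule (Algebra.adjoin K
      (Set.range (fun (i : Fin d) (t : Fin d → Kˣ) => (t i : K)) ∪
        Set.range (fun (i : Fin d) (t : Fin d → Kˣ) => ((t i)⁻¹ : K)))) := hg
  rw [Algebra.adjoin_eq_span] at h
  have h2 := Submodule.span_mono (R := K)
    (t := Set.range fun (m : Fin d → ℤ) (t : Fin d → Kˣ) => (monomial m t : K)) hmon h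
  obtain ⟨a, ha⟩ := Finsupp.mem_span_range_iff_exists_finsupp.1 h2
  refine ⟨a, fun t => ?_⟩
  rw [← ha]
  simp [Finsupp.sum]

theorem isIrreducible_of_noZeroDivisors {X : AffineVariety K} [Nonempty X.pts]
    (h : ∀ f ∈ X.reg, ∀ g ∈ X.reg, (∀ x, f x * g x = 0) → (∀ x, f x = 0) ∨ ∀ x, g x = 0) :
    X.IsIrreducible := by
  refine ⟨inferInstance, ?_⟩
  rintro _ _ ⟨F, hF, rfl⟩ ⟨G, hG, rfl⟩ hU
  by_contra! hne
  obtain ⟨x, hx⟩ := (Set.ne_univ_iff_exists_notMem _).1 hne.1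
  obtain ⟨y, hy⟩ := (Set.ne_univ_iff_exists_notMem _).1 hne.2
  simp only [Set.mem_ofPred_eq, not_forall] at hx hy
  obtain ⟨f, hf, hfx⟩ := hx
  obtain ⟨g, hg, hgy⟩ := hy
  have hfg : ∀ p, f p * g p = 0 := fun p => by
    rcases hU.ge (Set.mem_univ p) with hp | hp
    · rw [hp f hf, zero_mul]
    · rw [hp g hg, mul_zero]
  rcases h f (hF hf) g (hG hg) hfg with h1 | h1
  · exact hfx (h1 x)
  · exact hgy (h1 y)

/-- A power of the product of the coordinates clears the denominators of a Laurent polynomial. -/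
theorem exists_mvPolynomial_of_mem_torus_reg {d : ℕ} {g : (Fin d → Kˣ) → K}
    (hg : g ∈ (torus K d).reg) :
    ∃ (k : ℕ) (p : MvPolynomial (Fin d) K),
      ∀ t : Fin d → Kˣ, g t * (∏ i, (t i : K)) ^ k = p.eval fun i => (t i : K) := by
  induction hg using Algebra.adjoin_induction with
  | mem f hf =>
    rcases hf with ⟨i, rfl⟩ | ⟨i, rfl⟩
    · exact ⟨0, MvPolynomial.X i, by simp⟩
    · refine ⟨1, ∏ j ∈ Finset.univ.erase i, MvPolynomial.X j, fun t => ?_⟩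
      rw [← Finset.mul_prod_erase _ _ (Finset.mem_univ i)]
      simp [map_prod]
  | algebraMap c => exact ⟨0, MvPolynomial.C c, by simp⟩
  | add f g _ _ hf hg =>
    obtain ⟨k, p, hp⟩ := hf
    obtain ⟨l, q, hq⟩ := hg
    refine ⟨k + l, p * (∏ i, MvPolynomial.X i) ^ l + q * (∏ i, MvPolynomial.X i) ^ k, fun t => ?_⟩
    simp only [map_add, map_mul, map_pow, map_prod, MvPolynomial.eval_X, ← hp, ← hq, Pi.add_apply]
    ring
  | mul f g _ _ hf hg =>
    obtain ⟨k, p, hp⟩ := hf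
    obtain ⟨l, q, hq⟩ := hg
    refine ⟨k + l, p * q, fun t => ?_⟩
    simp only [map_mul, ← hp, ← hq, Pi.mul_apply]
    ring

theorem isIrreducible_torus [Infinite K] (d : ℕ) : (torus K d).IsIrreducible := by
  have : Nonempty (torus K d).pts := ⟨(1 : Fin d → Kˣ)⟩
  refine isIrreducible_of_noZeroDivisors fun f hf g hg hfg => ?_
  obtain ⟨k, p, hp⟩ := exists_mvPolynomial_of_mem_torus_reg hf
  obtain ⟨l, q, hq⟩ := exists_mvPolynomial_of_mem_torus_reg hg
  have hpq : p * q = 0 := by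
    have hs : ({0}ᶜ : Set K).Infinite := (Set.finite_singleton 0).infinite_compl
    refine MvPolynomial.funext_set (fun _ => {0}ᶜ) (fun _ => hs) fun x hx => ?_
    have h0 : ∀ i, x i ≠ 0 := fun i => hx i (Set.mem_univ i)
    let t : Fin d → Kˣ := fun i => Units.mk0 (x i) (h0 i)
    have h1 := hp t
    have h2 := hq t
    have h3 : f t * g t = 0 := hfg t
    change _ = MvPolynomial.eval x p at h1
    change _ = MvPolynomial.eval x q at h2
    rw [map_mul, map_zero, ← h1, ← h2, mul_mul_mul_comm, h3, zero_mul]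
  have hne : ∀ (t : Fin d → Kˣ) (k : ℕ), (∏ i, (t i : K)) ^ k ≠ 0 := fun t k =>
    pow_ne_zero _ (Finset.prod_ne_zero_iff.2 fun i _ => (t i).ne_zero)
  rcases mul_eq_zero.1 hpq with rfl | rfl
  · exact Or.inl fun t => (mul_eq_zero.1 ((hp t).trans (map_zero _))).resolve_right (hne t k)
  · exact Or.inr fun t => (mul_eq_zero.1 ((hq t).trans (map_zero _))).resolve_right (hne t l)

/-- On an irreducible variety, a unit of finite order is constant. -/
theorem eq_of_pow_eq_one [IsAlgClosed K] {S : AffineVariety K} (hS : S.IsIrreducible)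
    {u : S.pts → Kˣ} (hu : u ∈ S.regularUnits) {k : ℕ} (hk : k ≠ 0) (h : ∀ s, u s ^ k = 1)
    (s s' : S.pts) : u s = u s' := by
  have := hS.isDomain
  let f : S.reg := ⟨_, hu.1⟩
  have hf : f ^ k = 1 := by
    apply Subtype.ext
    funext s
    exact congrArg Units.val (h s)
  obtain ⟨c, hc⟩ := exists_algebraMap_eq_of_isIntegral (K := K)
    (IsIntegral.of_pow (Nat.pos_of_ne_zero hk) (hf ▸ isIntegral_one) : IsIntegral K f)
  have h1 : ∀ s, (u s : K) = c := fun s => (congrFun (congrArg Subtype.val hc) s).symm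
  exact Units.ext ((h1 s).trans (h1 s').symm)

/-! ### Homomorphisms of tori dual to homomorphisms of lattices -/

/-- The homomorphism `(K^*)ʳ → (K^*)ᵈ` dual to a homomorphism `ℤᵈ → ℤʳ` of character lattices. -/
def dualHom {d r : ℕ} (q : (Fin d → ℤ) →ₗ[ℤ] (Fin r → ℤ)) : (Fin r → Kˣ) →* (Fin d → Kˣ) :=
  MonoidHom.mk' (fun t i => monomial (q (Pi.single i 1)) t) fun s t => by
    funext i
    simp

theorem monomial_dualHom {d r : ℕ} (q : (Fin d → ℤ) →ₗ[ℤ] (Fin r → ℤ)) (m : Fin d → ℤ)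
    (t : Fin r → Kˣ) : monomial m (dualHom q t) = monomial (q m) t := by
  rw [LinearMap.pi_apply_eq_sum_univ q m, monomial_sum, monomial_apply]
  refine Finset.prod_congr rfl fun i _ => ?_
  have hi : (fun j => if i = j then 1 else 0) = (Pi.single i 1 : Fin d → ℤ) := by
    ext j
    simp [Pi.single_apply, eq_comm]
  rw [monomial_zsmul, hi]
  rfl

theorem eq_of_monomial_eq {d : ℕ} {s t : Fin d → Kˣ} (h : ∀ m, monomial m s = monomial m t) :
    s = t := by
  funext i
  simpa [monomial_single] using h (Pi.single i 1)

/-- A saturated sublattice `N` of `ℤᵈ` is the kernel of a split surjection onto some `ℤʳ`. -/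
theorem exists_split_surjection {d : ℕ} (N : Submodule ℤ (Fin d → ℤ))
    (hN : ∀ (k : ℤ) (m : Fin d → ℤ), k ≠ 0 → k • m ∈ N → m ∈ N) :
    ∃ (r : ℕ) (q : (Fin d → ℤ) →ₗ[ℤ] (Fin r → ℤ)) (c : (Fin r → ℤ) →ₗ[ℤ] (Fin d → ℤ)),
      LinearMap.ker q = N ∧ q ∘ₗ c = LinearMap.id := by
  have : Module.IsTorsionFree ℤ ((Fin d → ℤ) ⧸ N) := by
    rw [Module.isTorsionFree_iff_smul_eq_zero]
    intro k x hx
    obtain ⟨m, rfl⟩ := N.mkQ_surjective x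
    by_contra! hk
    rw [← map_smul, Submodule.mkQ_apply, Submodule.Quotient.mk_eq_zero] at hx
    exact hk.2 ((Submodule.Quotient.mk_eq_zero N).2 (hN k m hk.1 hx))
  let e := (Module.finBasis ℤ ((Fin d → ℤ) ⧸ N)).equivFun
  obtain ⟨c, hc⟩ := Module.projective_lifting_property (e.toLinearMap ∘ₗ N.mkQ) LinearMap.id
    (e.surjective.comp N.mkQ_surjective)
  exact ⟨_, e.toLinearMap ∘ₗ N.mkQ, c, by simp [LinearMap.ker_comp], hc⟩

/-! ### Embeddings into tori and translations -/

/-- The group of the translations of a group that preserve a given subset. -/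
def translationStabilizer {G : Type*} [CommGroup G] (Z : Set G) : Subgroup G where
  carrier := {h | ∀ y, h * y ∈ Z ↔ y ∈ Z}
  one_mem' := by simp
  mul_mem' {a b} ha hb y := by rw [mul_assoc, ha, hb]
  inv_mem' {a} ha y := by rw [← ha, mul_inv_cancel_left]

theorem mem_translationStabilizer_of_forall {G : Type*} [CommGroup G] {Z : Set G} {h : G}
    (h₁ : ∀ y ∈ Z, h * y ∈ Z) (h₂ : ∀ y ∈ Z, h⁻¹ * y ∈ Z) : h ∈ translationStabilizer Z :=
  fun y => ⟨fun hy => by simpa using h₂ _ hy, h₁ y⟩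

/-- `z` is an isomorphism of `X` onto a closed subvariety of the torus `(K^*)ᵈ`, viewed as a map
to the torus. -/
structure IsTorusEmbedding (X : AffineVariety K) {d : ℕ} (z : X.pts → Fin d → Kˣ) : Prop where
  injective : Function.Injective z
  isZariskiClosed_range : (torus K d).IsZariskiClosed (Set.range z)
  mem_reg_iff : ∀ f, f ∈ X.reg ↔ ∃ g ∈ (torus K d).reg, (fun x => g (z x)) = f

theorem mem_closedSubvariety_reg {X : AffineVariety K} {Z : Set X.pts} (hZ : X.IsZariskiClosed Z)
    (f : Z → K) :
    f ∈ (X.closedSubvariety Z hZ).reg ↔ ∃ g ∈ X.reg, (fun y : Z => g y.1) = f := by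
  change f ∈ X.reg.map (pullback K (Subtype.val : Z → X.pts)) ↔ _
  exact Subalgebra.mem_map

theorem IsToral.exists_isTorusEmbedding {X : AffineVariety K} (hX : X.IsToral) :
    ∃ (d : ℕ) (z : X.pts → Fin d → Kˣ), X.IsTorusEmbedding z := by
  obtain ⟨-, d, Z, hZ, e, he, he'⟩ := hX
  refine ⟨d, fun x => (e x).1, fun x y h => e.injective (Subtype.ext h), ?_,
    fun f => ⟨fun hf => ?_, ?_⟩⟩
  · convert hZ
    ext y
    exact ⟨by rintro ⟨x, rfl⟩; exact (e x).2, fun hy => ⟨e.symm ⟨y, hy⟩,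
      congrArg Subtype.val (e.apply_symm_apply ⟨y, hy⟩)⟩⟩
  · obtain ⟨g, hg, hgf⟩ := (mem_closedSubvariety_reg hZ _).1 (he' f hf)
    refine ⟨g, hg, funext fun x => ?_⟩
    have := congrFun hgf (e x)
    simpa using this
  · rintro ⟨g, hg, rfl⟩
    exact he _ ((mem_closedSubvariety_reg hZ _).2 ⟨g, hg, rfl⟩)

theorem isTorusEmbedding_val {d : ℕ} {Z : Set (Fin d → Kˣ)}
    (hZ : (torus K d).IsZariskiClosed Z) :
    ((torus K d).closedSubvariety Z hZ).IsTorusEmbedding fun y => y.1 where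
  injective := Subtype.val_injective
  isZariskiClosed_range := by
    have h : Set.range (fun y : Z => y.1) = Z := Subtype.range_val
    exact h.symm ▸ hZ
  mem_reg_iff f := mem_closedSubvariety_reg hZ f

namespace IsTorusEmbedding

variable {X : AffineVariety K} {d : ℕ} {z : X.pts → Fin d → Kˣ}

theorem coord_mem_regularUnits (hz : X.IsTorusEmbedding z) (i : Fin d) :
    (fun x => z x i) ∈ X.regularUnits :=
  ⟨(hz.mem_reg_iff _).2 ⟨_, (coord_mem_regularUnits_torus d i).1, rfl⟩,
    (hz.mem_reg_iff _).2 ⟨_, (coord_mem_regularUnits_torus d i).2, rfl⟩⟩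

theorem isRegularMap (hz : X.IsTorusEmbedding z) {P : AffineVariety K} {φ : P.pts → X.pts}
    (hφ : ∀ i, (fun p => z (φ p) i) ∈ P.regularUnits) : P.IsRegularMap X φ := by
  intro f hf
  obtain ⟨g, hg, rfl⟩ := (hz.mem_reg_iff f).1 hf
  exact isRegularMap_torus hφ g hg

end IsTorusEmbedding

/-- The translation by an element of the stabilizer of the image of `z`, as a map on the source. -/
noncomputable def translate {α G : Type*} [CommGroup G] (z : α → G)
    (h : translationStabilizer (Set.range z)) (x : α) : α :=
  ((h.2 (z x)).2 ⟨x, rfl⟩).choose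

theorem apply_translate {α G : Type*} [CommGroup G] (z : α → G)
    (h : translationStabilizer (Set.range z)) (x : α) : z (translate z h x) = h * z x :=
  ((h.2 (z x)).2 ⟨x, rfl⟩).choose_spec

namespace IsTorusEmbedding

variable {X : AffineVariety K} {d : ℕ} {z : X.pts → Fin d → Kˣ}

/-- The action of the stabilizer of `X ⊆ (K^*)ᵈ` on `X` by translations. -/
noncomputable def translateHom (hz : X.IsTorusEmbedding z) :
    translationStabilizer (Set.range z) →* X.Aut :=
  have hreg : ∀ h, X.IsRegularMap X (translate z h) := fun h => hz.isRegularMap fun i => by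
    convert X.regularUnits.mul_mem (X.const_mem_regularUnits (h.1 i)) (hz.coord_mem_regularUnits i)
      using 1
    funext x
    exact congrFun (apply_translate z h x) i
  { toFun h := ⟨⟨translate z h, translate z h⁻¹,
      fun x => hz.injective (by simp [apply_translate]),
      fun x => hz.injective (by simp [apply_translate])⟩, hreg h, hreg h⁻¹⟩
    map_one' := Subtype.ext (Equiv.ext fun x => hz.injective (by simp [apply_translate]))
    map_mul' h h' := Subtype.ext (Equiv.ext fun x => hz.injective
      (by simp [apply_translate, mul_assoc])) }

theorem apply_translateHom (hz : X.IsTorusEmbedding z)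
    (h : translationStabilizer (Set.range z)) (x : X.pts) :
    z ((hz.translateHom h).1 x) = h * z x :=
  apply_translate z h x

theorem translateHom_injective (hz : X.IsTorusEmbedding z) [Nonempty X.pts] :
    Function.Injective hz.translateHom := by
  intro h h' e
  obtain ⟨x⟩ := ‹Nonempty X.pts›
  apply Subtype.ext
  have h1 := hz.apply_translateHom h x
  rw [e, hz.apply_translateHom] at h1
  exact (mul_right_cancel h1).symm

/-- By Rosenlicht's lemma, the members of an irreducible algebraic family of automorphisms of a
subvariety of a torus differ by translations of the torus. -/
theorem exists_translation [IsAlgClosed K] (hz : X.IsTorusEmbedding z) (hX : X.IsIrreducible)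
    {S : AffineVariety K} (hS : S.IsIrreducible) (Φ : S.pts → X.Aut)
    (hΦ : (S.prod X).IsRegularMap X fun p => (Φ p.1).1 p.2) (s₀ : S.pts) :
    ∃ c : S.pts → Fin d → Kˣ, (∀ i, (fun s => c s i) ∈ S.regularUnits) ∧ c s₀ = 1 ∧
      (∀ s, c s ∈ translationStabilizer (Set.range z)) ∧
      ∀ s x, z ((Φ s).1 x) = c s * z ((Φ s₀).1 x) := by
  obtain ⟨x₀⟩ := hX.1
  have hu : ∀ i, (fun p : S.pts × X.pts => z ((Φ p.1).1 p.2) i) ∈ (S.prod X).regularUnits :=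
    fun i => hΦ.comp_mem_regularUnits (hz.coord_mem_regularUnits i)
  have hc : ∀ s x, z ((Φ s).1 x) = z ((Φ s).1 x₀) / z ((Φ s₀).1 x₀) * z ((Φ s₀).1 x) := by
    intro s x
    funext i
    apply Units.ext
    have h := mul_eq_mul_of_unit_prod hS hX (hu i).1 (hu i).2
      (fun p => mul_inv_cancel₀ (Units.ne_zero _)) s s₀ x x₀
    simp only [Pi.mul_apply, Pi.div_apply, Units.val_mul, Units.val_div_eq_div_val]
    rw [div_mul_eq_mul_div, eq_div_iff (Units.ne_zero _)]
    exact h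
  have hi : S.IsRegularMap (S.prod X) fun s => (s, x₀) :=
    IsRegularMap.prodMk (fun g hg => hg) (fun g _ => S.reg.algebraMap_mem (g x₀))
  refine ⟨fun s => z ((Φ s).1 x₀) / z ((Φ s₀).1 x₀), fun i => ?_, div_self' _, fun s y => ?_, hc⟩
  · exact S.regularUnits.div_mem (hi.comp_mem_regularUnits (hu i))
      (S.const_mem_regularUnits (z ((Φ s₀).1 x₀) i))
  · constructor
    · rintro ⟨x, hx⟩
      obtain ⟨x, rfl⟩ := (Φ s).1.surjective x
      rw [hc] at hx
      exact ⟨_, mul_left_cancel hx⟩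
    · rintro ⟨x, rfl⟩
      obtain ⟨x, rfl⟩ := (Φ s₀).1.surjective x
      exact ⟨_, hc s x⟩

end IsTorusEmbedding

/-! ### The neutral component of the stabilizer -/

/-- The stabilizer of a closed subset of a torus is cut out by characters. This is linear
independence of characters of the stabilizer, applied to the equations of the closed subset. -/
theorem mem_translationStabilizer_of_monomial {d : ℕ} {Z : Set (Fin d → Kˣ)}
    (hZ : (torus K d).IsZariskiClosed Z) {t : Fin d → Kˣ}
    (ht : ∀ m, (∀ h ∈ translationStabilizer Z, monomial m h = 1) → monomial m t = 1) :
    t ∈ translationStabilizer Z := by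
  suffices key : ∀ t : Fin d → Kˣ,
      (∀ m, (∀ h ∈ translationStabilizer Z, monomial m h = 1) → monomial m t = 1) →
        ∀ y ∈ Z, t * y ∈ Z by
    refine mem_translationStabilizer_of_forall (key t ht) (key t⁻¹ fun m hm => ?_)
    rw [map_inv, ht m hm, inv_one]
  intro t ht y hy
  have hH : ∀ h : translationStabilizer Z, (h : Fin d → Kˣ) * y ∈ Z := fun h => (h.2 y).2 hy
  obtain ⟨F, hF, rfl⟩ := hZ
  intro f hf
  obtain ⟨a, ha⟩ := exists_finsupp_of_mem_torus_reg (hF hf)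
  set H := translationStabilizer {x : Fin d → Kˣ | ∀ f ∈ F, f x = 0} with hHdef
  let char : (Fin d → ℤ) → (H →* K) := fun m =>
    (Units.coeHom K).comp ((monomial m).comp H.subtype)
  -- the coefficients of `h ↦ f (h * y)` as a combination of characters of `H`
  let b : (H →* K) →₀ K := a.sum fun m c => Finsupp.single (char m) (c * (monomial m y : K))
  have hb : b = 0 := by
    apply linearIndependent_iff.1 (linearIndependent_monoidHom H K)
    funext h
    have h0 : f (h.1 * y) = 0 := hH h f hf
    rw [ha] at h0
    rw [Pi.zero_apply, ← h0]
    simp only [b, Finsupp.sum, map_sum, Finsupp.linearCombination_single, Finset.sum_apply,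
      Pi.smul_apply, smul_eq_mul]
    refine Finset.sum_congr rfl fun m _ => ?_
    simp only [map_mul, Units.val_mul, char]
    rw [mul_assoc, mul_comm (monomial m y : K)]
    rfl
  -- replacing the characters of `H` by their values at `t` is well defined by `ht`, and it turns
  -- the vanishing combination into `f (t * y)`
  let ev : (H →* K) → K := Function.extend char (fun m => (monomial m t : K)) 0
  have hev : ∀ m, ev (char m) = (monomial m t : K) := by
    refine fun m => Function.FactorsThrough.extend_apply (f := char) (fun m n hmn => ?_) _ m
    have h1 := ht (m - n) fun h hh => by
      have h2 := DFunLike.congr_fun hmn ⟨h, hh⟩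
      rw [monomial_sub, div_eq_one]
      exact Units.ext h2
    rw [monomial_sub, div_eq_one] at h1
    exact congrArg Units.val h1
  have h1 : Finsupp.linearCombination K ev b = 0 := by rw [hb, map_zero]
  rw [show f (t * y) = _ from ha _, ← h1]
  simp only [b, Finsupp.sum, map_sum, Finsupp.linearCombination_single, hev, smul_eq_mul]
  refine Finset.sum_congr rfl fun m _ => ?_
  rw [map_mul, Units.val_mul]
  ring

/-- The exponents of the characters of finite order on a subgroup `H` of a torus. -/
def finiteOrderExponents {d : ℕ} (H : Subgroup (Fin d → Kˣ)) : Submodule ℤ (Fin d → ℤ) where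
  carrier := {m | ∃ k : ℕ, k ≠ 0 ∧ ∀ h ∈ H, monomial m h ^ k = 1}
  zero_mem' := ⟨1, one_ne_zero, by simp [monomial_zero]⟩
  add_mem' := by
    rintro m n ⟨k, hk, hm⟩ ⟨l, hl, hn⟩
    refine ⟨k * l, mul_ne_zero hk hl, fun h hh => ?_⟩
    rw [monomial_add, mul_pow, pow_mul, hm h hh, mul_comm k, pow_mul, hn h hh, one_pow, one_pow,
      one_mul]
  smul_mem' := by
    rintro c m ⟨k, hk, hm⟩
    refine ⟨k, hk, fun h hh => ?_⟩
    rw [monomial_zsmul, ← zpow_natCast, zpow_comm, zpow_natCast, hm h hh, one_zpow]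

theorem mem_finiteOrderExponents_of_smul_mem {d : ℕ} {H : Subgroup (Fin d → Kˣ)} {k : ℤ}
    {m : Fin d → ℤ} (hk : k ≠ 0) (h : k • m ∈ finiteOrderExponents H) :
    m ∈ finiteOrderExponents H := by
  obtain ⟨l, hl, h⟩ := h
  refine ⟨k.natAbs * l, mul_ne_zero (Int.natAbs_ne_zero.2 hk) hl, fun t ht => ?_⟩
  have h1 := h t ht
  rw [monomial_zsmul] at h1
  rcases Int.natAbs_eq k with h2 | h2
  · rw [h2, zpow_natCast] at h1
    rw [pow_mul, h1]
  · rw [h2, zpow_neg, zpow_natCast, inv_pow, inv_eq_one] at h1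
    rw [pow_mul, h1]

/-- The subgroup of a torus cut out by the characters that have finite order on `H`. For `K`
algebraically closed and `H` Zariski closed it is the neutral component of `H`. -/
def neutralComponent {d : ℕ} (H : Subgroup (Fin d → Kˣ)) : Subgroup (Fin d → Kˣ) :=
  ⨅ m ∈ finiteOrderExponents H, (monomial m).ker

theorem mem_neutralComponent {d : ℕ} {H : Subgroup (Fin d → Kˣ)} {t : Fin d → Kˣ} :
    t ∈ neutralComponent H ↔ ∀ m ∈ finiteOrderExponents H, monomial m t = 1 := by
  simp [neutralComponent, Subgroup.mem_iInf, MonoidHom.mem_ker]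

theorem neutralComponent_translationStabilizer_le {d : ℕ} {Z : Set (Fin d → Kˣ)}
    (hZ : (torus K d).IsZariskiClosed Z) :
    neutralComponent (translationStabilizer Z) ≤ translationStabilizer Z := fun t ht =>
  mem_translationStabilizer_of_monomial hZ fun m hm =>
    mem_neutralComponent.1 ht m ⟨1, one_ne_zero, fun h hh => by rw [hm h hh, one_pow]⟩

/-- An irreducible family in `H` passing through `1` stays in the neutral component: a character of
finite order on `H` is constant on the family. -/
theorem mem_neutralComponent_of_isIrreducible [IsAlgClosed K] {d : ℕ} {H : Subgroup (Fin d → Kˣ)}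
    {S : AffineVariety K} (hS : S.IsIrreducible) {c : S.pts → Fin d → Kˣ}
    (hc : ∀ i, (fun s => c s i) ∈ S.regularUnits) (hcH : ∀ s, c s ∈ H) {s₀ : S.pts}
    (hs₀ : c s₀ = 1) (s : S.pts) : c s ∈ neutralComponent H := by
  rw [mem_neutralComponent]
  rintro m ⟨k, hk, hm⟩
  rw [eq_of_pow_eq_one hS (monomial_comp_mem_regularUnits hc m) hk (fun s => hm _ (hcH s)) s s₀,
    hs₀, map_one]

/-- The neutral component is a torus `(K^*)ʳ`, and a direct factor of the ambient torus. -/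
theorem exists_dualHom_neutralComponent {d : ℕ} (H : Subgroup (Fin d → Kˣ)) :
    ∃ (r : ℕ) (q : (Fin d → ℤ) →ₗ[ℤ] (Fin r → ℤ)) (c : (Fin r → ℤ) →ₗ[ℤ] (Fin d → ℤ)),
      (∀ t : Fin r → Kˣ, dualHom q t ∈ neutralComponent H) ∧
      (∀ t : Fin r → Kˣ, dualHom c (dualHom q t) = t) ∧
      ∀ h ∈ neutralComponent H, dualHom q (dualHom c h) = h := by
  obtain ⟨r, q, c, hq, hqc⟩ := exists_split_surjection (finiteOrderExponents H)
    fun k m hk h => mem_finiteOrderExponents_of_smul_mem hk h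
  refine ⟨r, q, c, fun t => mem_neutralComponent.2 fun m hm => ?_,
    fun t => eq_of_monomial_eq fun m => ?_, fun h hh => eq_of_monomial_eq fun m => ?_⟩
  · rw [← hq, LinearMap.mem_ker] at hm
    rw [monomial_dualHom, hm, monomial_zero]
  · rw [monomial_dualHom, monomial_dualHom, show q (c m) = m from DFunLike.congr_fun hqc m]
  · rw [monomial_dualHom, monomial_dualHom]
    have hker : c (q m) - m ∈ finiteOrderExponents H := by
      rw [← hq, LinearMap.mem_ker, map_sub, show q (c (q m)) = q m from DFunLike.congr_fun hqc _,
        sub_self]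
    have := mem_neutralComponent.1 hh _ hker
    rwa [monomial_sub, div_eq_one] at this

/-- The rank of a torus is determined by its abstract group: there are `2ⁿ` elements of order
dividing two in `(K^*)ⁿ`. -/
theorem torus_rank_eq [CharZero K] {n r : ℕ} (e : (Fin n → Kˣ) ≃* (Fin r → Kˣ)) : n = r := by
  have h2 : Nat.card {u : Kˣ // u ^ 2 = 1} = 2 := by
    rw [Nat.card_eq_two_iff]
    refine ⟨⟨1, one_pow 2⟩, ⟨-1, by simp⟩, fun h => ?_, ?_⟩
    · have h1 : (1 : K) = -1 := congrArg (fun u => ((u : Kˣ) : K)) (congrArg Subtype.val h)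
      norm_num [eq_neg_iff_add_eq_zero] at h1
    · refine Set.eq_univ_of_forall fun ⟨u, hu⟩ => ?_
      have h1 : u = 1 ∨ u = -1 :=
        (mul_self_eq_one_iff.1 ((pow_two (u : K)).symm.trans (congrArg Units.val hu))).imp
          Units.ext Units.ext
      rcases h1 with rfl | rfl <;> simp
  have hcard : ∀ n, Nat.card {t : Fin n → Kˣ // t ^ 2 = 1} = 2 ^ n := by
    intro n
    let f : {t : Fin n → Kˣ // t ^ 2 = 1} ≃ (Fin n → {u : Kˣ // u ^ 2 = 1}) :=
      ⟨fun t i => ⟨t.1 i, congrFun t.2 i⟩, fun t => ⟨fun i => (t i).1, funext fun i => (t i).2⟩,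
        fun _ => rfl, fun _ => rfl⟩
    rw [Nat.card_congr f, Nat.card_fun, h2, Nat.card_fin]
  have h := Nat.card_congr (e.toEquiv.subtypeEquiv (p := fun t => t ^ 2 = 1)
    (q := fun t => t ^ 2 = 1) fun t => by simp [← map_pow])
  rw [hcard, hcard] at h
  exact Nat.pow_right_injective le_rfl h

/-! ### The greatest torus -/

theorem dualHom_comp_mem_regularUnits {P : AffineVariety K} {d r : ℕ}
    (q : (Fin d → ℤ) →ₗ[ℤ] (Fin r → ℤ)) {u : P.pts → Fin r → Kˣ}
    (hu : ∀ i, (fun p => u p i) ∈ P.regularUnits) (i : Fin d) :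
    (fun p => dualHom q (u p) i) ∈ P.regularUnits :=
  monomial_comp_mem_regularUnits hu (q (Pi.single i 1))

theorem isTorusOfRank_of_translations {X : AffineVariety K} [Nonempty X.pts] {d : ℕ}
    {z : X.pts → Fin d → Kˣ} (hz : X.IsTorusEmbedding z) {r : ℕ}
    (q : (Fin d → ℤ) →ₗ[ℤ] (Fin r → ℤ)) (hq : Function.Injective (dualHom (K := K) q))
    (hqH : ∀ t, dualHom q t ∈ translationStabilizer (Set.range z)) :
    X.IsTorusOfRank r (hz.translateHom.comp ((dualHom q).codRestrict _ hqH)).range := by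
  refine ⟨_, ?_, rfl, ?_⟩
  · exact hz.translateHom_injective.comp fun s t h => hq (congrArg Subtype.val h)
  · refine hz.isRegularMap fun i => ?_
    have h1 : (fun p : (Fin r → Kˣ) × X.pts => dualHom q p.1 i) ∈
        ((torus K r).prod X).regularUnits :=
      dualHom_comp_mem_regularUnits q (fun j =>
        (isRegularMap_fst (torus K r) X).comp_mem_regularUnits (coord_mem_regularUnits_torus r j)) i
    have h2 := (isRegularMap_snd (torus K r) X).comp_mem_regularUnits (hz.coord_mem_regularUnits i)
    convert ((torus K r).prod X).regularUnits.mul_mem h1 h2 using 1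
    funext p
    exact congrFun (hz.apply_translateHom _ p.2) i

/-- Every torus acts through translations by elements of the neutral component of the stabilizer. -/
theorem exists_translation_of_torus_action [IsAlgClosed K] {X : AffineVariety K} {d : ℕ}
    {z : X.pts → Fin d → Kˣ} (hz : X.IsTorusEmbedding z) (hX : X.IsIrreducible) {n : ℕ}
    (ρ : (Fin n → Kˣ) →* X.Aut)
    (hρ : ((torus K n).prod X).IsRegularMap X fun p => (ρ p.1).1 p.2) (t : Fin n → Kˣ) :
    ∃ c ∈ neutralComponent (translationStabilizer (Set.range z)),
      ∀ x, z ((ρ t).1 x) = c * z x := by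
  obtain ⟨c, hc, hc1, hcH, hcz⟩ := hz.exists_translation hX (isIrreducible_torus n) ρ hρ
    (1 : Fin n → Kˣ)
  refine ⟨c t, mem_neutralComponent_of_isIrreducible (isIrreducible_torus n) hc hcH hc1 t,
    fun x => (hcz t x).trans (congrArg (fun y => c t * z y) ?_)⟩
  have h1 : (ρ 1).1 x = x := by
    rw [map_one]
    rfl
  exact h1

/-- The translations by the neutral component of the stabilizer form the greatest torus in
`Aut X`. -/
theorem exists_isGreatest_torus [IsAlgClosed K] {X : AffineVariety K} {d : ℕ}
    {z : X.pts → Fin d → Kˣ} (hz : X.IsTorusEmbedding z) (hX : X.IsIrreducible) {r : ℕ}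
    {q : (Fin d → ℤ) →ₗ[ℤ] (Fin r → ℤ)} {c : (Fin r → ℤ) →ₗ[ℤ] (Fin d → ℤ)}
    (hq : ∀ t, dualHom q t ∈ neutralComponent (translationStabilizer (Set.range z)))
    (hcq : ∀ t : Fin r → Kˣ, dualHom c (dualHom q t) = t)
    (hqc : ∀ h ∈ neutralComponent (translationStabilizer (Set.range z)),
      dualHom q (dualHom c h) = h) :
    ∃ T₀, X.IsTorusOfRank r T₀ ∧ ∀ T, X.IsTorus T → T ≤ T₀ := by
  have : Nonempty X.pts := hX.1
  refine ⟨_, isTorusOfRank_of_translations hz q (Function.LeftInverse.injective hcq)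
    fun t => neutralComponent_translationStabilizer_le hz.isZariskiClosed_range (hq t), ?_⟩
  rintro _ ⟨n, ρ, -, rfl, hρ⟩ _ ⟨t, rfl⟩
  obtain ⟨h, hh, hhz⟩ := exists_translation_of_torus_action hz hX ρ hρ t
  refine ⟨dualHom c h, Subtype.ext (Equiv.ext fun x => hz.injective ?_)⟩
  rw [hhz]
  refine (hz.apply_translateHom _ x).trans ?_
  exact congrArg (· * z x) (hqc h hh)

theorem isTorus_bot (X : AffineVariety K) : X.IsTorus ⊥ := by
  refine ⟨0, 1, Function.injective_of_subsingleton _, MonoidHom.range_one, isRegularMap_snd _ X⟩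

theorem HasDiscreteAut.eq_bot [IsAlgClosed K] {Y : AffineVariety K} (hY : Y.HasDiscreteAut)
    {T : Subgroup Y.Aut} (hT : Y.IsTorus T) : T = ⊥ := by
  obtain ⟨n, ρ, -, rfl, hρ⟩ := hT
  have hinv : ((torus K n).prod Y).IsRegularMap ((torus K n).prod Y)
      fun p : (Fin n → Kˣ) × Y.pts => ((p.1⁻¹, p.2) : (Fin n → Kˣ) × Y.pts) := by
    refine IsRegularMap.prodMk (X := torus K n) (isRegularMap_torus fun i => ?_)
      (isRegularMap_snd _ _)
    exact ((torus K n).prod Y).regularUnits.inv_mem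
      ((isRegularMap_fst (torus K n) Y).comp_mem_regularUnits (coord_mem_regularUnits_torus n i))
  have hfam : Y.IsAlgebraicFamily (torus K n) ρ := by
    refine ⟨hρ, ?_⟩
    convert hρ.comp hinv using 2 with p
    exact congrArg (fun σ : Y.Aut => σ.1 p.2) (ρ.map_inv p.1).symm
  rw [eq_bot_iff]
  rintro _ ⟨t, rfl⟩
  exact Subgroup.mem_bot.2
    ((hY _ (isIrreducible_torus n) ρ hfam t (1 : Fin n → Kˣ)).trans (map_one ρ))

theorem HasDiscreteAut.isMaximalTorus_iff [IsAlgClosed K] {Y : AffineVariety K}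
    (hY : Y.HasDiscreteAut) (T : Subgroup Y.Aut) : Y.IsMaximalTorus T ↔ T = ⊥ := by
  refine ⟨fun h => hY.eq_bot h.prop, ?_⟩
  rintro rfl
  exact ⟨isTorus_bot Y, fun T hT _ => (hY.eq_bot hT).le⟩

/-! ### The complement of the greatest torus -/

theorem Isomorphic.refl (X : AffineVariety K) : X.Isomorphic X :=
  ⟨Equiv.refl _, fun _ hg => hg, fun _ hg => hg⟩

theorem IsIrreducible.of_surjective {X Y : AffineVariety K} (hX : X.IsIrreducible)
    {f : X.pts → Y.pts} (hf : X.IsRegularMap Y f) (hs : Function.Surjective f) :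
    Y.IsIrreducible := by
  have : Nonempty Y.pts := hX.1.map f
  refine isIrreducible_of_noZeroDivisors fun g hg h hh hgh => ?_
  by_contra! hne
  obtain ⟨⟨y, hy⟩, y', hy'⟩ := hne
  obtain ⟨x, rfl⟩ := hs y
  obtain ⟨x', rfl⟩ := hs y'
  obtain ⟨p, hp, hp'⟩ := hX.exists_ne_zero (hf g hg) (hf h hh) (fun h => hy (congrFun h x))
    (fun h => hy' (congrFun h x'))
  exact mul_ne_zero hp hp' (hgh (f p))

/-- The slice of a subset of a torus on which the coordinates of the split subtorus are `1`. -/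
def slice {d r : ℕ} (Z : Set (Fin d → Kˣ)) (c : (Fin r → ℤ) →ₗ[ℤ] (Fin d → ℤ)) :
    Set (Fin d → Kˣ) :=
  {y | y ∈ Z ∧ dualHom c y = 1}

theorem isZariskiClosed_slice {d r : ℕ} {Z : Set (Fin d → Kˣ)}
    (hZ : (torus K d).IsZariskiClosed Z) (c : (Fin r → ℤ) →ₗ[ℤ] (Fin d → ℤ)) :
    (torus K d).IsZariskiClosed (slice Z c) := by
  obtain ⟨F, hF, rfl⟩ := hZ
  refine ⟨F ∪ Set.range fun (j : Fin r) (t : Fin d → Kˣ) => (dualHom c t j : K) - 1,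
    Set.union_subset hF ?_, ?_⟩
  · rintro _ ⟨j, rfl⟩
    exact (torus K d).reg.sub_mem
      (dualHom_comp_mem_regularUnits c (coord_mem_regularUnits_torus d) j).1 (torus K d).reg.one_mem
  · ext t
    constructor
    · rintro ⟨h1, h2⟩ f (hf | ⟨j, rfl⟩)
      · exact h1 f hf
      · simp [h2]
    · intro h
      refine ⟨fun f hf => h f (Or.inl hf), funext fun j => Units.ext ?_⟩
      exact sub_eq_zero.1 (h _ (Or.inr ⟨j, rfl⟩))

section Slice

variable {d r : ℕ} {Z : Set (Fin d → Kˣ)} {q : (Fin d → ℤ) →ₗ[ℤ] (Fin r → ℤ)}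
  {c : (Fin r → ℤ) →ₗ[ℤ] (Fin d → ℤ)}

theorem mul_inv_mem_slice (hq : ∀ t, dualHom q t ∈ translationStabilizer Z)
    (hcq : ∀ t : Fin r → Kˣ, dualHom c (dualHom q t) = t) {y : Fin d → Kˣ} (hy : y ∈ Z) :
    (dualHom q (dualHom c y))⁻¹ * y ∈ slice Z c := by
  refine ⟨((inv_mem (hq (dualHom c y))) y).2 hy, ?_⟩
  rw [map_mul, map_inv, hcq, inv_mul_cancel]

/-- A translation preserving the slice preserves `Z`, which is swept out by the translates of the
slice under the split subtorus. -/
theorem translationStabilizer_slice_le (hq : ∀ t, dualHom q t ∈ translationStabilizer Z)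
    (hcq : ∀ t : Fin r → Kˣ, dualHom c (dualHom q t) = t) :
    translationStabilizer (slice Z c) ≤ translationStabilizer Z := by
  have key : ∀ h ∈ translationStabilizer (slice Z c), ∀ y ∈ Z, h * y ∈ Z := by
    intro h hh y hy
    have h1 := ((hh _).2 (mul_inv_mem_slice hq hcq hy)).1
    have h2 := (hq (dualHom c y) _).2 h1
    rwa [mul_left_comm, mul_inv_cancel_left] at h2
  exact fun h hh => mem_translationStabilizer_of_forall (key h hh) (key _ (inv_mem hh))

/-- Members of a family of automorphisms of the slice differ by translations in the neutral
component of the stabilizer of `Z`, that is in the split subtorus; that subtorus meets the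
stabilizer of the slice trivially. -/
theorem hasDiscreteAut_slice [IsAlgClosed K] (hZ : (torus K d).IsZariskiClosed (slice Z c))
    (hY : ((torus K d).closedSubvariety (slice Z c) hZ).IsIrreducible)
    (hq : ∀ t, dualHom q t ∈ translationStabilizer Z)
    (hcq : ∀ t : Fin r → Kˣ, dualHom c (dualHom q t) = t)
    (hqc : ∀ h ∈ neutralComponent (translationStabilizer Z), dualHom q (dualHom c h) = h) :
    ((torus K d).closedSubvariety (slice Z c) hZ).HasDiscreteAut := by
  intro S hS Φ hΦ s s₀
  have hz := isTorusEmbedding_val hZ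
  obtain ⟨b, hb, hb1, hbH, hbz⟩ := hz.exists_translation hY hS Φ hΦ.1 s₀
  have hrange : Set.range (fun y : slice Z c => y.1) = slice Z c := Subtype.range_val
  replace hbH : ∀ s, b s ∈ translationStabilizer (slice Z c) := fun s => hrange ▸ hbH s
  have h1 : b s ∈ neutralComponent (translationStabilizer Z) :=
    mem_neutralComponent_of_isIrreducible hS hb
      (fun s => translationStabilizer_slice_le hq hcq (hbH s)) hb1 s
  have h2 : dualHom c (b s) = 1 := by
    obtain ⟨y, hy⟩ : Nonempty (slice Z c) := hY.1
    have := ((hbH s y).2 hy).2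
    rwa [map_mul, hy.2, mul_one] at this
  have h3 : b s = 1 := by rw [← hqc _ h1, h2, map_one]
  refine Subtype.ext (Equiv.ext fun x => hz.injective ?_)
  refine (hbz s x).trans ?_
  rw [h3]
  exact one_mul _

end Slice

/-- Acting by the split subtorus on the slice identifies `X` with the product of the two. -/
theorem isomorphic_slice_prod_torus {X : AffineVariety K} {d r : ℕ} {z : X.pts → Fin d → Kˣ}
    (hz : X.IsTorusEmbedding z) {q : (Fin d → ℤ) →ₗ[ℤ] (Fin r → ℤ)}
    {c : (Fin r → ℤ) →ₗ[ℤ] (Fin d → ℤ)}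
    (hZ : (torus K d).IsZariskiClosed (slice (Set.range z) c))
    (hq : ∀ t, dualHom q t ∈ translationStabilizer (Set.range z))
    (hcq : ∀ t : Fin r → Kˣ, dualHom c (dualHom q t) = t) :
    X.Isomorphic (((torus K d).closedSubvariety _ hZ).prod (torus K r)) := by
  let Y := (torus K d).closedSubvariety _ hZ
  have hlift : ∀ p : slice (Set.range z) c × (Fin r → Kˣ), ∃ x, z x = dualHom q p.2 * p.1.1 :=
    fun p => ((hq p.2) _).2 p.1.2.1
  choose g hg using hlift
  let f : X.pts → slice (Set.range z) c := fun x => ⟨_, mul_inv_mem_slice hq hcq ⟨x, rfl⟩⟩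
  have hzc : ∀ i, (fun x => dualHom c (z x) i) ∈ X.regularUnits :=
    dualHom_comp_mem_regularUnits c hz.coord_mem_regularUnits
  have hf : X.IsRegularMap Y f := (isTorusEmbedding_val hZ).isRegularMap fun i =>
    X.regularUnits.mul_mem (X.regularUnits.inv_mem (dualHom_comp_mem_regularUnits q hzc i))
      (hz.coord_mem_regularUnits i)
  let e : X.pts ≃ slice (Set.range z) c × (Fin r → Kˣ) :=
    { toFun x := (f x, dualHom c (z x))
      invFun := g
      left_inv x := hz.injective ((hg _).trans (mul_inv_cancel_left _ _))
      right_inv p := by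
        have h1 : dualHom c (z (g p)) = p.2 := by
          rw [hg, map_mul, hcq, p.1.2.2, mul_one]
        refine Prod.ext (Subtype.ext ?_) h1
        change (dualHom q (dualHom c (z (g p))))⁻¹ * z (g p) = _
        rw [h1, hg, inv_mul_cancel_left] }
  refine ⟨e, hf.prodMk (isRegularMap_torus hzc), hz.isRegularMap fun i => ?_⟩
  · have h1 : (fun p : slice (Set.range z) c × (Fin r → Kˣ) => dualHom q p.2 i) ∈
        (Y.prod (torus K r)).regularUnits :=
      dualHom_comp_mem_regularUnits q (fun j =>
        (isRegularMap_snd Y (torus K r)).comp_mem_regularUnits (coord_mem_regularUnits_torus r j)) i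
    have h2 := (isRegularMap_fst Y (torus K r)).comp_mem_regularUnits
      ((isTorusEmbedding_val hZ).coord_mem_regularUnits i)
    convert (Y.prod (torus K r)).regularUnits.mul_mem h1 h2 using 1
    funext p
    exact congrFun (hg p) i

end AffineVariety

open AffineVariety

theorem theorem1 {K : Type u} [Field K] [IsAlgClosed K] [CharZero K] [Uncountable K]
    (X : AffineVariety K) (hX : X.IsToral) :
    (∃! T : Subgroup X.Aut, X.IsMaximalTorus T) ∧
    ∀ T : Subgroup X.Aut, X.IsMaximalTorus T → ∀ n : ℕ, X.IsTorusOfRank n T →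
      ∃ Y : AffineVariety K, Y.IsToral ∧ Y.HasDiscreteAut ∧
        (∀ T' : Subgroup Y.Aut, Y.IsMaximalTorus T' ↔ T' = ⊥) ∧
        X.Isomorphic (Y.prod (AffineVariety.torus K n)) := by
  obtain ⟨d, z, hz⟩ := hX.exists_isTorusEmbedding
  obtain ⟨r, q, c, hq, hcq, hqc⟩ :=
    exists_dualHom_neutralComponent (translationStabilizer (Set.range z))
  obtain ⟨T₀, hT₀, hmax⟩ := exists_isGreatest_torus hz hX.1 hq hcq hqc
  have huniq : ∀ T, X.IsMaximalTorus T → T = T₀ := fun T hT =>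
    (hmax T hT.prop).antisymm (hT.le_of_ge ⟨r, hT₀⟩ (hmax T hT.prop))
  refine ⟨⟨T₀, ⟨⟨r, hT₀⟩, fun T hT _ => hmax T hT⟩, huniq⟩, ?_⟩
  rintro T hT n ⟨ρ, hρ, hρT, -⟩
  obtain ⟨ρ₀, hρ₀, hρ₀T, -⟩ := hT₀
  obtain rfl : n = r := torus_rank_eq <| (MonoidHom.ofInjective hρ).trans <|
    (MulEquiv.subgroupCongr (by rw [hρT, hρ₀T, huniq T hT])).trans (MonoidHom.ofInjective hρ₀).symm
  have hqH : ∀ t, dualHom q t ∈ translationStabilizer (Set.range z) := fun t =>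
    neutralComponent_translationStabilizer_le hz.isZariskiClosed_range (hq t)
  have hZ := isZariskiClosed_slice hz.isZariskiClosed_range c
  have hiso := isomorphic_slice_prod_torus hz hZ hqH hcq
  have hY : ((torus K d).closedSubvariety _ hZ).IsIrreducible := by
    obtain ⟨e, he, -⟩ := hiso
    have : Nonempty (torus K n).pts := ⟨(1 : Fin n → Kˣ)⟩
    exact hX.1.of_surjective ((isRegularMap_fst _ _).comp he)
      (Prod.fst_surjective.comp e.surjective)
  have hdisc := hasDiscreteAut_slice hZ hY hqH hcq hqc
  exact ⟨_, ⟨hY, d, _, hZ, Isomorphic.refl _⟩, hdisc, hdisc.isMaximalTorus_iff, hiso⟩
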